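/- **Definitions.** A Petri net $N=(P,T,W)$ has finite disjoint sets $P$ of places and $T$ of transitions and a weight function $W:(P\times T)\cup(T\times P)\to\mathbb N$; its incidence matrix is $I(p,t)=W(t,p)-W(p,t)$. A marking is a map $M:P\to\mathbb N$. A transition $t$ is enabled at $M$ if $M(p)\ge W(p,t)$ for all $p$; firing it leads to $M+I(\cdot,t)$. For a system $S=(N,M_0)$, $R(S)$ is the set of markings reachable from $M_0$ by finite firing sequences, and $PR(S)=\{M\in\mathbb N^P\mid \exists Y\in\mathbb N^T,\ M=M_0+I\cdot Y\}$. $S$ satisfies the PR-R equality if $R(S)=PR(S)$. $S$ is live if for every transition $t$ and every $M\in R(S)$ some marking reachable from $M$ enables $t$; it is bounded if some $k\in\mathbb N$ satisfies $M(p)\le k$ for all $M\in R(S)$ and $p\in P$; it is reversible if $M_0$ is reachable from every $M\in R(S)$. $N$ is well-formed if $(N,M)$ is bounded for every marking $M$ and live for at least one marking $M$. The reverse $-S=(-N,M_0)$ is obtained by reversing all arcs of $N$ while keeping their weights. $S$ satisfies property $\mathcal R$ if both $S$ and $-S$ are reversible. An MG$_\le$ is a net all of whose arc weights are at most $1$ and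 in which each place has at most one input transition and at most one output transition; it is an MG (marked graph) if each place has exactly one input and exactly one output transition. Given a family $A$ of mutually disjoint sets of places of a net, place-merging $A$ replaces each $x\in A$ by one place $p_x$ with $W(p_x,t)=\sum_{p\in x}W(p,t)$ and $W(t,p_x)=\sum_{p\in x}W(t,p)$ for every transition $t$, and keeps all other places unchanged. Let $G=(V,E)$ be a finite, connected, simple undirected graph. A PCMG$_\le$ obtained from $G$ is a net constructed as follows. Take an MG$_\le$ $N'$ with $|E|$ maximal connected components, each containing at least two places, and a bijection $\beta$ from $E$ onto the set of these components. For each edge $e=\{v,w\}$, choose two distinct places of $\beta(e)$, one associated to $v$ and the other to $w$. For each vertex $v$, let $A_v$ be the set of all places associated to $v$. Then place-merge $\{A_v\mid v\in V\}$ in $N'$. The PCMG$_\le$ is well-structured if each component of $N'$ is a strongly connected and well-formed MG. **Corollary.** Let $S=(N,M_0)$ be a live system whose net $N$ is a well-structured PCMG$_\le$ obtained from an acyclic (finite, connected, simple) undirected graph. Then $S$ satisfies property $\mathcal R$ (both $S$ and $-S$ are reversible), and $S$ satisfies the PR-R equality $R(S)=PR(S)$. -/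

import Mathlib

/-- A Petri net with place type `P` and transition type `T`; the weight function `W` is split into
`pre p t = W(p,t)` and `post t p = W(t,p)`. -/
structure PetriNet (P T : Type*) where
  pre : P → T → ℕ
  post : T → P → ℕ

/-- A Petri net system: a net together with an initial marking. -/
structure PetriSystem (P T : Type*) where
  net : PetriNet P T
  init : P → ℕ

namespace PetriNet

variable {P T : Type*}

/-- The incidence matrix `I(p,t) = W(t,p) - W(p,t)`. -/
def incidence (N : PetriNet P T) : Matrix P T ℤ :=
  fun p t => (N.post t p : ℤ) - (N.pre p t : ℤ)

/-- The pre-set of a place: the transitions `t` with `W(t,p) > 0`. -/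
def inputs (N : PetriNet P T) (p : P) : Set T := {t | 0 < N.post t p}

/-- The post-set of a place: the transitions `t` with `W(p,t) > 0`. -/
def outputs (N : PetriNet P T) (p : P) : Set T := {t | 0 < N.pre p t}

/-- The arcs of the net, as a relation on its nodes (places and transitions). -/
def Arc (N : PetriNet P T) : P ⊕ T → P ⊕ T → Prop
  | Sum.inl p, Sum.inr t => 0 < N.pre p t
  | Sum.inr t, Sum.inl p => 0 < N.post t p
  | _, _ => False

/-- Every node can be reached from every node by a directed path. -/
def StronglyConnected (N : PetriNet P T) : Prop :=
  ∀ x y : P ⊕ T, Relation.ReflTransGen N.Arc x y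

/-- The undirected graph on places and transitions that underlies the net. -/
def underlyingGraph (N : PetriNet P T) : SimpleGraph (P ⊕ T) := SimpleGraph.fromRel N.Arc

/-- The maximal connected components of the net. -/
abbrev Component (N : PetriNet P T) : Type _ := N.underlyingGraph.ConnectedComponent

/-- The connected component in which a node lies. -/
def componentOf (N : PetriNet P T) (x : P ⊕ T) : N.Component :=
  N.underlyingGraph.connectedComponentMk x

/-- The subnet formed by the places and transitions of a connected component. -/
def componentNet (N : PetriNet P T) (c : N.Component) :
    PetriNet {p : P // N.componentOf (Sum.inl p) = c} {t : T // N.componentOf (Sum.inr t) = c} where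
  pre p t := N.pre p.1 t.1
  post t p := N.post t.1 p.1

/-- No arc weight exceeds one. -/
def Ordinary (N : PetriNet P T) : Prop :=
  ∀ (p : P) (t : T), N.pre p t ≤ 1 ∧ N.post t p ≤ 1

/-- A unit-weighted marked graph with relaxed place constraints: each place has at most one input
and at most one output. -/
def IsMGLe (N : PetriNet P T) : Prop :=
  N.Ordinary ∧ ∀ p : P, (N.inputs p).encard ≤ 1 ∧ (N.outputs p).encard ≤ 1

/-- A marked graph: unit-weighted, and each place has exactly one input and one output. -/
def IsMG (N : PetriNet P T) : Prop :=
  N.Ordinary ∧ ∀ p : P, (N.inputs p).encard = 1 ∧ (N.outputs p).encard = 1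

/-- The transition `t` is enabled at the marking `M`. -/
def Enabled (N : PetriNet P T) (M : P → ℕ) (t : T) : Prop := ∀ p : P, N.pre p t ≤ M p

/-- Firing `t` at `M` is possible and leads to `M'`. -/
def Fires (N : PetriNet P T) (M : P → ℕ) (t : T) (M' : P → ℕ) : Prop :=
  N.Enabled M t ∧ ∀ p : P, (M' p : ℤ) = (M p : ℤ) + N.incidence p t

/-- The finite sequence `σ` is feasible at `M` and leads to `M'`. -/
def FiresSeq (N : PetriNet P T) : (P → ℕ) → List T → (P → ℕ) → Prop
  | M, [], M' => M' = M
  | M, t :: σ, M' => ∃ M₁ : P → ℕ, N.Fires M t M₁ ∧ N.FiresSeq M₁ σ M'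

/-- The reverse net `-N`: all arcs are reversed and keep their weights. -/
def reverse (N : PetriNet P T) : PetriNet P T where
  pre p t := N.post t p
  post t p := N.pre p t

/-- Place-merging of the family `A` of mutually disjoint sets of places: each `x ∈ A` becomes one
place whose arc weights are the sums over `x`; places in no member of `A` are kept unchanged. -/
def placeMerge (N : PetriNet P T) (A : Set (Finset P)) :
    PetriNet ({x : Finset P // x ∈ A} ⊕ {p : P // ∀ x ∈ A, p ∉ x}) T where
  pre q t := match q with
    | Sum.inl x => ∑ p ∈ x.1, N.pre p t
    | Sum.inr p => N.pre p.1 t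
  post t q := match q with
    | Sum.inl x => ∑ p ∈ x.1, N.post t p
    | Sum.inr p => N.post t p.1

end PetriNet

namespace PetriSystem

variable {P T : Type*}

/-- The set `R(S)` of reachable markings. -/
def reach (S : PetriSystem P T) : Set (P → ℕ) :=
  {M | ∃ σ : List T, S.net.FiresSeq S.init σ M}

/-- The set `PR(S)` of potentially reachable markings: the markings `M` for which the state
equation `M = M₀ + I · Y` has a solution `Y ∈ ℕ^T`. -/
def potReach [Fintype T] (S : PetriSystem P T) : Set (P → ℕ) :=
  {M | ∃ Y : T → ℕ, ∀ p : P,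
    (M p : ℤ) = (S.init p : ℤ) + S.net.incidence.mulVec (fun t => (Y t : ℤ)) p}

/-- The PR-R equality `R(S) = PR(S)`. -/
def PRREquality [Fintype T] (S : PetriSystem P T) : Prop := S.reach = S.potReach

/-- Liveness: from every reachable marking, every transition can be enabled again. -/
def Live (S : PetriSystem P T) : Prop :=
  ∀ t : T, ∀ M ∈ S.reach, ∃ M' ∈ reach ⟨S.net, M⟩, S.net.Enabled M' t

/-- Boundedness: one bound for all places and all reachable markings. -/
def Bounded (S : PetriSystem P T) : Prop :=
  ∃ k : ℕ, ∀ M ∈ S.reach, ∀ p : P, M p ≤ k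

/-- Reversibility: the initial marking is reachable from every reachable marking. -/
def Reversible (S : PetriSystem P T) : Prop :=
  ∀ M ∈ S.reach, S.init ∈ reach ⟨S.net, M⟩

/-- The reverse system `-S = (-N, M₀)`. -/
def reverse (S : PetriSystem P T) : PetriSystem P T := ⟨S.net.reverse, S.init⟩

/-- Property `R`: the system and its reverse are reversible. -/
def PropertyR (S : PetriSystem P T) : Prop := S.Reversible ∧ S.reverse.Reversible

end PetriSystem

namespace PetriNet

variable {P T : Type*}

/-- Structural liveness: some marking makes the net live. -/
def StructurallyLive (N : PetriNet P T) : Prop := ∃ M : P → ℕ, PetriSystem.Live ⟨N, M⟩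

/-- Structural boundedness: every marking makes the net bounded. -/
def StructurallyBounded (N : PetriNet P T) : Prop := ∀ M : P → ℕ, PetriSystem.Bounded ⟨N, M⟩

/-- Well-formedness: structurally live and structurally bounded. -/
def WellFormed (N : PetriNet P T) : Prop := N.StructurallyBounded ∧ N.StructurallyLive

end PetriNet

/-- The data from which a place-composed marked graph with relaxed place constraints is obtained
from the undirected graph `G`. The places `(γ d, γ d.symm)` for the two orientations `d`, `d.symm`
of an edge `{a, b}` are the pair of places associated to that edge, `γ d` being the one that belongs
to the vertex `d.fst`. -/
structure PCMGLe {V : Type*} (G : SimpleGraph V) (P T : Type*) where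
  /-- the graph is connected -/
  connected : G.Connected
  /-- the net whose components refine the edges -/
  base : PetriNet P T
  base_isMGLe : base.IsMGLe
  /-- each connected component contains at least two places -/
  two_places : ∀ c : base.Component, ∃ p q : P, p ≠ q ∧
    base.componentOf (Sum.inl p) = c ∧ base.componentOf (Sum.inl q) = c
  /-- the bijection between edges and components -/
  β : G.edgeSet ≃ base.Component
  /-- the place that an oriented edge associates to its first endpoint -/
  γ : G.Dart → P
  γ_mem : ∀ d : G.Dart, base.componentOf (Sum.inl (γ d)) = β ⟨d.edge, d.edge_mem⟩
  γ_ne : ∀ d : G.Dart, γ d ≠ γ d.symm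

namespace PCMGLe

variable {V P T : Type*} {G : SimpleGraph V}

open Classical in
/-- The set `A_v` of all the places associated to the vertex `v`. -/
noncomputable def block [Fintype P] (C : PCMGLe G P T) (v : V) : Finset P :=
  Finset.univ.filter (fun p => ∃ d : G.Dart, d.fst = v ∧ C.γ d = p)

/-- The places of the composed net. -/
abbrev Place [Fintype P] (C : PCMGLe G P T) : Type _ :=
  {x : Finset P // x ∈ Set.range C.block} ⊕ {p : P // ∀ x ∈ Set.range C.block, p ∉ x}

/-- The composed net, obtained by place-merging `A = {A_v | v ∈ V}`. -/
noncomputable def net [Fintype P] (C : PCMGLe G P T) : PetriNet C.Place T :=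
  C.base.placeMerge (Set.range C.block)

/-- Each component is a strongly connected and well-formed marked graph. -/
def WellStructured (C : PCMGLe G P T) : Prop :=
  ∀ c : C.base.Component, (C.base.componentNet c).StronglyConnected ∧
    (C.base.componentNet c).WellFormed ∧ (C.base.componentNet c).IsMG

end PCMGLe

/-! ### Firing restricted to a set of transitions, and marked graphs inside a net. -/

namespace PetriNet

variable {P T : Type*}

/-! In a tree, a connected vertex set grows one vertex at a time, and each new vertex contributes
exactly one edge. The net is thus built by gluing strongly connected marked graphs one after
another, each meeting the earlier part in a single merged place. The invariant carried along is
`PRRVia`: from a live marking, every solution of the state equation is reachable. Counts are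
integers rather than naturals, so that the invariant also yields a way back from every reachable
marking; reversibility of the system and of its reverse follows at once.

For a single marked graph `B`, the invariant is the classical fact that the state equation decides
reachability once every directed cycle carries a token (`IsBlock.reachVia`).

The gluing step (`PRRVia.union`) joins `A` and `B` at a place `p`. First `B` puts as many tokens on
`p` as it ever can; this is bounded because `B` is strongly connected. From then on `A` never needs
help from `B`, hence is live on its own (`LiveVia.of_maximal`), and its share of the firing counts
is realizable by the invariant. By maximality the remaining count of `B` adds nothing to `p`, so the
intermediate marking is nonnegative. It remains to fire the share of `B`, which requires its cycles
to be marked. Cycles avoiding `p` are marked by liveness; those through `p` are marked if `p` is. If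
`p` is empty, `A` lends it a token, `B` fires, and `A` undoes its detour. -/

/-- `M'` is reachable from `M` by firing transitions of `A` only. -/
def ReachVia (N : PetriNet P T) (A : Set T) : (P → ℕ) → (P → ℕ) → Prop :=
  Relation.ReflTransGen fun M M' => ∃ t ∈ A, N.Fires M t M'

/-- Liveness of the subnet that keeps only the transitions of `A`. -/
def LiveVia (N : PetriNet P T) (A : Set T) (M : P → ℕ) : Prop :=
  ∀ t ∈ A, ∀ M', N.ReachVia A M M' → ∃ M'', N.ReachVia A M' M'' ∧ N.Enabled M'' t

/-- No transition of `A` is adjacent to the place `q`. -/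
def Apart (N : PetriNet P T) (A : Set T) (q : P) : Prop :=
  ∀ t ∈ A, N.pre q t = 0 ∧ N.post t q = 0

/-- Every solution of the state equation over the transitions of `A`, from a marking that is live
with respect to `A`, is reachable by transitions of `A`. -/
def PRRVia [Fintype T] (N : PetriNet P T) (A : Set T) : Prop :=
  ∀ M : P → ℕ, N.LiveVia A M → ∀ Y : T → ℤ, (∀ t ∉ A, Y t = 0) → ∀ M' : P → ℕ,
    (∀ q, (M' q : ℤ) = M q + N.incidence.mulVec Y q) → N.ReachVia A M M'

/-- The transitions of `B` span a strongly connected marked graph. -/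
structure IsBlock (N : PetriNet P T) (B : Set T) : Prop where
  pre_le : ∀ q, ∀ t ∈ B, N.pre q t ≤ 1
  post_le : ∀ q, ∀ t ∈ B, N.post t q ≤ 1
  pre_unique : ∀ q, ∀ s ∈ B, ∀ t ∈ B, 0 < N.pre q s → 0 < N.pre q t → s = t
  post_unique : ∀ q, ∀ s ∈ B, ∀ t ∈ B, 0 < N.post s q → 0 < N.post t q → s = t
  balanced : ∀ q, (∃ t ∈ B, 0 < N.pre q t) ↔ ∃ t ∈ B, 0 < N.post t q
  connected : ∀ s ∈ B, ∀ t ∈ B, Relation.ReflTransGen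
    (fun s t => t ∈ B ∧ ∃ q, 0 < N.post s q ∧ 0 < N.pre q t) s t

/-- A directed cycle of `B`, traversed against the arcs: the place `q i` leads from `τ (i + 1)`
to `τ i`. -/
structure IsCycle (N : PetriNet P T) (B : Set T) (n : ℕ) (τ : ℕ → T) (q : ℕ → P) : Prop where
  pos : 0 < n
  closed : τ n = τ 0
  mem : ∀ i, τ i ∈ B
  post_pos : ∀ i, 0 < N.post (τ (i + 1)) (q i)
  pre_pos : ∀ i, 0 < N.pre (q i) (τ i)

/-- Every directed cycle of `B` carries a token. -/
def CyclesMarked (N : PetriNet P T) (B : Set T) (M : P → ℕ) : Prop :=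
  ∀ n τ q, N.IsCycle B n τ q → 0 < ∑ i ∈ Finset.range n, M (q i)

variable {N : PetriNet P T} {A B : Set T} {M M' M'' : P → ℕ}

lemma ReachVia.trans (h : N.ReachVia A M M') (h' : N.ReachVia A M' M'') : N.ReachVia A M M'' :=
  Relation.ReflTransGen.trans h h'

lemma ReachVia.mono (hAB : A ⊆ B) (h : N.ReachVia A M M') : N.ReachVia B M M' :=
  Relation.ReflTransGen.mono (fun _ _ ⟨t, ht, hf⟩ => ⟨t, hAB ht, hf⟩) _ _ h

lemma LiveVia.of_reachVia (h : N.LiveVia A M) (h' : N.ReachVia A M M') : N.LiveVia A M' :=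
  fun t ht _ hX => h t ht _ (h'.trans hX)

lemma Enabled.exists_fires {t : T} (h : N.Enabled M t) : ∃ M', N.Fires M t M' := by
  refine ⟨fun q => M q - N.pre q t + N.post t q, h, fun q => ?_⟩
  have := h q
  simp only [incidence]
  omega

lemma exists_marking [Fintype T] {Y : T → ℤ} (h : ∀ q, 0 ≤ (M q : ℤ) + N.incidence.mulVec Y q) :
    ∃ M' : P → ℕ, ∀ q, (M' q : ℤ) = M q + N.incidence.mulVec Y q :=
  ⟨fun q => ((M q : ℤ) + N.incidence.mulVec Y q).toNat, fun q => Int.toNat_of_nonneg (h q)⟩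

lemma Apart.incidence_eq {q : P} (h : N.Apart A q) {t : T} (ht : t ∈ A) : N.incidence q t = 0 := by
  simp [incidence, h t ht]

/-- An unmarked cycle fed only by its own transitions is an empty siphon: each transition that could
put a token on it also needs a token from it. It would stay empty forever and its transitions would
be dead. -/
lemma LiveVia.cycle_marked {U : Set T} (h : N.LiveVia U M) {n : ℕ} {τ : ℕ → T} {q : ℕ → P}
    (hc : N.IsCycle U n τ q) (hin : ∀ i < n, ∀ s ∈ U, 0 < N.post s (q i) → s = τ (i + 1)) :
    0 < ∑ i ∈ Finset.range n, M (q i) := by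
  by_contra hcon
  have hz : ∀ i < n, M (q i) = 0 := by
    have := Finset.sum_eq_zero_iff.1 (Nat.eq_zero_of_not_pos hcon)
    exact fun i hi => this i (Finset.mem_range.2 hi)
  have inv : ∀ X, N.ReachVia U M X → ∀ i < n, X (q i) = 0 := by
    intro X hX
    induction hX with
    | refl => exact hz
    | tail _ hf ih =>
      obtain ⟨s, hs, hen, heq⟩ := hf
      intro i hi
      have h1 := heq (q i)
      have : N.post s (q i) = 0 := by
        by_contra h0
        have hsi := hin i hi s hs (Nat.pos_of_ne_zero h0)
        obtain ⟨j, hj, hsj⟩ : ∃ j < n, s = τ j := by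
          -- Only the places with index below `n` are known to be empty, so the index `i + 1 = n` is
          -- wrapped around to `0`.
          rcases Nat.lt_or_ge (i + 1) n with h | h
          · exact ⟨i + 1, h, hsi⟩
          · refine ⟨0, hc.pos, ?_⟩
            rw [hsi, show i + 1 = n by omega, hc.closed]
        have h2 := hen (q j)
        have h3 := hc.pre_pos j
        rw [ih j hj, hsj] at h2
        omega
      simp only [incidence, this, ih i hi] at h1
      omega
  obtain ⟨X, hX, hen⟩ := h _ (hc.mem 0) M Relation.ReflTransGen.refl
  have h1 := hen (q 0)
  have h2 := hc.pre_pos 0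
  rw [inv X hX 0 hc.pos] at h1
  omega

section Fintype

variable [Fintype T]

lemma Apart.mulVec_eq {q : P} (h : N.Apart A q) {Y : T → ℤ} (hY : ∀ t ∉ A, Y t = 0) :
    N.incidence.mulVec Y q = 0 := by
  refine Finset.sum_eq_zero fun t _ => ?_
  by_cases ht : t ∈ A
  · simp [h.incidence_eq ht]
  · simp [hY t ht]

open Classical in
lemma mulVec_single_one_apply (N : PetriNet P T) (t : T) (q : P) :
    N.incidence.mulVec (Pi.single t 1) q = N.incidence q t := by
  simp

lemma ReachVia.exists_mulVec (h : N.ReachVia A M M') :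
    ∃ Y : T → ℤ, (∀ t ∉ A, Y t = 0) ∧ ∀ q, (M' q : ℤ) = M q + N.incidence.mulVec Y q := by
  classical
  induction h with
  | refl => exact ⟨0, fun _ _ => rfl, fun q => by simp⟩
  | tail _ h ih =>
    obtain ⟨Y, hY, hM⟩ := ih
    obtain ⟨t, ht, hf⟩ := h
    refine ⟨Y + Pi.single t 1, fun s hs => ?_, fun q => ?_⟩
    · have : s ≠ t := fun h => hs (h ▸ ht)
      simp [hY s hs, this]
    · rw [hf.2 q, hM q, Matrix.mulVec_add, Pi.add_apply, mulVec_single_one_apply, add_assoc]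

lemma IsBlock.mulVec_eq (hB : N.IsBlock B) {q : P} {s t : T} (hs : s ∈ B) (ht : t ∈ B)
    (hsq : 0 < N.post s q) (htq : 0 < N.pre q t) {Z : T → ℤ} (hZ : ∀ t ∉ B, Z t = 0) :
    N.incidence.mulVec Z q = Z s - Z t := by
  have h1 : ∑ u, (N.post u q : ℤ) * Z u = Z s := by
    rw [Finset.sum_eq_single s]
    · have := hB.post_le q s hs
      rw [show N.post s q = 1 by omega]; simp
    · intro u _ hu
      by_cases huB : u ∈ B
      · have : N.post u q = 0 := by
          by_contra h
          exact hu (hB.post_unique q u huB s hs (Nat.pos_of_ne_zero h) hsq)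
        simp [this]
      · simp [hZ u huB]
    · simp
  have h2 : ∑ u, (N.pre q u : ℤ) * Z u = Z t := by
    rw [Finset.sum_eq_single t]
    · have := hB.pre_le q t ht
      rw [show N.pre q t = 1 by omega]; simp
    · intro u _ hu
      by_cases huB : u ∈ B
      · have : N.pre q u = 0 := by
          by_contra h
          exact hu (hB.pre_unique q u huB t ht (Nat.pos_of_ne_zero h) htq)
        simp [this]
      · simp [hZ u huB]
    · simp
  rw [← h1, ← h2, ← Finset.sum_sub_distrib]
  exact Finset.sum_congr rfl fun u _ => sub_mul _ _ _

lemma IsBlock.apart_or (hB : N.IsBlock B) (q : P) :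
    N.Apart B q ∨ ∃ s ∈ B, ∃ t ∈ B, 0 < N.post s q ∧ 0 < N.pre q t := by
  by_cases h : ∃ t ∈ B, 0 < N.pre q t
  · obtain ⟨s, hs, hsq⟩ := (hB.balanced q).1 h
    obtain ⟨t, ht, htq⟩ := h
    exact Or.inr ⟨s, hs, t, ht, hsq, htq⟩
  · refine Or.inl fun t ht => ⟨?_, ?_⟩
    · by_contra h0
      exact h ⟨t, ht, Nat.pos_of_ne_zero h0⟩
    · by_contra h0
      exact h ((hB.balanced q).2 ⟨t, ht, Nat.pos_of_ne_zero h0⟩)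

/-- The token count of a cycle is invariant under `B`: along the cycle the changes `Z (τ (i + 1)) -
Z (τ i)` telescope. Since `Z` may be negative, the invariance holds for all solutions of the state
equation, not only for firing sequences. -/
lemma IsCycle.sum_eq (hB : N.IsBlock B) {n : ℕ} {τ : ℕ → T} {q : ℕ → P} (hc : N.IsCycle B n τ q)
    {Z : T → ℤ} (hZ : ∀ t ∉ B, Z t = 0)
    (hM : ∀ q, (M' q : ℤ) = M q + N.incidence.mulVec Z q) :
    ∑ i ∈ Finset.range n, M' (q i) = ∑ i ∈ Finset.range n, M (q i) := by
  have h : ∀ i, N.incidence.mulVec Z (q i) = Z (τ (i + 1)) - Z (τ i) := fun i =>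
    hB.mulVec_eq (hc.mem _) (hc.mem _) (hc.post_pos i) (hc.pre_pos i) hZ
  zify
  simp only [hM, h]
  rw [Finset.sum_add_distrib, Finset.sum_range_sub (fun i => Z (τ i)), hc.closed]
  simp

lemma CyclesMarked.of_mulVec (hB : N.IsBlock B) (h : N.CyclesMarked B M)
    {Z : T → ℤ} (hZ : ∀ t ∉ B, Z t = 0)
    (hM : ∀ q, (M' q : ℤ) = M q + N.incidence.mulVec Z q) : N.CyclesMarked B M' :=
  fun n τ q hc => (hc.sum_eq hB hZ hM).symm ▸ h n τ q hc

/-- If every transition still to be fired were blocked, walking backwards through empty input places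
would never leave the set `0 < Z t`, and by finiteness would close up to an unmarked cycle. -/
lemma IsBlock.exists_enabled (hB : N.IsBlock B) (h : N.CyclesMarked B M)
    {Z : T → ℤ} (hZ : ∀ t ∉ B, Z t = 0) {t₀ : T} (ht₀ : 0 < Z t₀)
    (hM : ∀ q, (M' q : ℤ) = M q + N.incidence.mulVec Z q) :
    ∃ t, 0 < Z t ∧ N.Enabled M t := by
  by_contra! hcon
  have hmem : ∀ t, 0 < Z t → t ∈ B := fun t ht => by
    by_contra hn
    exact ht.ne' (hZ t hn)
  have key : ∀ t : {t // 0 < Z t}, ∃ (s : {t // 0 < Z t}) (q : P), M q = 0 ∧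
      0 < N.post s.1 q ∧ 0 < N.pre q t.1 := by
    rintro ⟨t, ht⟩
    have htB := hmem t ht
    have hne := hcon t ht
    simp only [Enabled, not_forall, not_le] at hne
    obtain ⟨q, hq⟩ := hne
    have hle := hB.pre_le q t htB
    have htq : 0 < N.pre q t := by omega
    obtain ⟨s, hs, hsq⟩ := (hB.balanced q).1 ⟨t, htB, htq⟩
    have hMq : M q = 0 := by omega
    -- Here `0 ≤ M' q = Z s - Z t`, so the transition `s` that feeds the empty place also has a
    -- positive count.
    have h1 := hM q
    rw [hB.mulVec_eq hs htB hsq htq hZ, hMq] at h1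
    exact ⟨⟨s, by push_cast at h1; omega⟩, q, hMq, hsq, htq⟩
  choose f q hq0 hpost hpre using key
  obtain ⟨i, j, hij, hne⟩ : ∃ i j, i < j ∧ f^[i] ⟨t₀, ht₀⟩ = f^[j] ⟨t₀, ht₀⟩ := by
    obtain ⟨i, j, hij, he⟩ :=
      Finite.exists_ne_map_eq_of_infinite fun n : ℕ => f^[n] ⟨t₀, ht₀⟩
    rcases lt_or_gt_of_ne hij with h | h
    · exact ⟨i, j, h, he⟩
    · exact ⟨j, i, h, he.symm⟩
  have hc : N.IsCycle B (j - i) (fun k => (f^[i + k] ⟨t₀, ht₀⟩).1)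
      (fun k => q (f^[i + k] ⟨t₀, ht₀⟩)) := by
    refine ⟨by omega, ?_, fun k => hmem _ (f^[i + k] ⟨t₀, ht₀⟩).2, fun k => ?_, fun k => hpre _⟩
    · simp only [add_zero]
      rw [show i + (j - i) = j by omega, hne]
    · rw [show i + (k + 1) = (i + k).succ by omega, Function.iterate_succ_apply']
      exact hpost _
  have := h _ _ _ hc
  simp [hq0] at this

lemma IsBlock.reachVia_of_nonneg (hB : N.IsBlock B) (n : ℕ) : ∀ {M : P → ℕ} {Z : T → ℤ},
    N.CyclesMarked B M → (∀ t ∉ B, Z t = 0) → 0 ≤ Z → ∑ t, Z t = n →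
    (∀ q, (M' q : ℤ) = M q + N.incidence.mulVec Z q) → N.ReachVia B M M' := by
  classical
  induction n with
  | zero =>
    intro M Z _ _ h0 hsum hM
    have hz : Z = 0 := by
      have := (Finset.sum_eq_zero_iff_of_nonneg (fun t _ => h0 t)).1 (by simpa using hsum)
      exact funext fun t => this t (Finset.mem_univ t)
    have : M' = M := funext fun q => by simpa [hz] using hM q
    exact this ▸ Relation.ReflTransGen.refl
  | succ n ih =>
    intro M Z hc hZ h0 hsum hM
    obtain ⟨t₀, ht₀⟩ : ∃ t, 0 < Z t := by
      by_contra! hn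
      have : ∑ t, Z t ≤ 0 := Finset.sum_nonpos fun t _ => hn t
      push_cast at hsum
      omega
    obtain ⟨t, ht, hen⟩ := hB.exists_enabled hc hZ ht₀ hM
    obtain ⟨M₁, hf⟩ := hen.exists_fires
    have htB : t ∈ B := by
      by_contra hn
      exact ht.ne' (hZ t hn)
    have hs : ∀ u ∉ B, (Pi.single t 1 : T → ℤ) u = 0 := fun u hu => by
      have : u ≠ t := fun h => hu (h ▸ htB)
      simp [this]
    refine Relation.ReflTransGen.head ⟨t, htB, hf⟩ (ih (Z := Z - Pi.single t 1) ?_ ?_ ?_ ?_ ?_)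
    · exact hc.of_mulVec hB hs fun q => by rw [mulVec_single_one_apply, hf.2 q]
    · intro u hu
      rw [Pi.sub_apply, hZ u hu, hs u hu, sub_zero]
    · intro u
      by_cases hu : u = t
      · subst hu
        simp only [Pi.zero_apply, Pi.sub_apply, Pi.single_eq_same]
        omega
      · simpa [hu] using h0 u
    · simp only [Pi.sub_apply, Finset.sum_sub_distrib, hsum]
      simp
    · intro q
      rw [Matrix.mulVec_sub, Pi.sub_apply, mulVec_single_one_apply, hf.2 q, hM q]
      ring

/-- The state equation characterizes reachability in a marked graph whose cycles are marked. -/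
lemma IsBlock.reachVia (hB : N.IsBlock B) (hc : N.CyclesMarked B M) {Z : T → ℤ}
    (hZ : ∀ t ∉ B, Z t = 0) (hM : ∀ q, (M' q : ℤ) = M q + N.incidence.mulVec Z q) :
    N.ReachVia B M M' := by
  classical
  set k : ℤ := ∑ t, |Z t|
  have hk : ∀ t, -Z t ≤ k := fun t => (neg_le_abs _).trans
    (Finset.single_le_sum (f := fun t => |Z t|) (fun _ _ => abs_nonneg _) (Finset.mem_univ t))
  have hk0 : 0 ≤ k := Finset.sum_nonneg fun _ _ => abs_nonneg _
  -- Firing every transition of `B` equally often changes no marking, so adding the constant `k` on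
  -- `B` makes the counts nonnegative.
  set O : T → ℤ := fun t => if t ∈ B then k else 0 with hO
  have hOB : ∀ t ∉ B, O t = 0 := fun t ht => by simp [hO, ht]
  have hI : ∀ q, N.incidence.mulVec O q = 0 := fun q => by
    rcases hB.apart_or q with h | ⟨s, hs, t, ht, hsq, htq⟩
    · exact h.mulVec_eq hOB
    · rw [hB.mulVec_eq hs ht hsq htq hOB]
      simp [hO, hs, ht]
  have h0 : 0 ≤ Z + O := fun t => by
    by_cases ht : t ∈ B
    · have := hk t
      simp only [hO, Pi.zero_apply, Pi.add_apply, ht, if_true]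
      omega
    · simp [hO, hZ t ht, ht]
  refine hB.reachVia_of_nonneg (∑ t, (Z + O) t).toNat (Z := Z + O) hc ?_ h0 ?_ fun q => ?_
  · intro t ht
    simp [hZ t ht, hOB t ht]
  · rw [Int.toNat_of_nonneg (Finset.sum_nonneg fun t _ => h0 t)]
  · rw [Matrix.mulVec_add, Pi.add_apply, hI, add_zero, hM q]

/-- Cycles avoiding `p` are fed by `B` alone, so liveness marks them; if `A` is empty this covers
all cycles. A cycle through `p` has the same token count in `M` as in `M'`, where `p` is marked. -/
lemma LiveVia.cyclesMarked (hB : N.IsBlock B) (p : P)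
    (hsep : ∀ q, q ≠ p → N.Apart A q ∨ N.Apart B q) (h : N.LiveVia (A ∪ B) M)
    {Z : T → ℤ} (hZ : ∀ t ∉ B, Z t = 0)
    (hM : ∀ q, (M' q : ℤ) = M q + N.incidence.mulVec Z q) (hp : A = ∅ ∨ 0 < M' p) :
    N.CyclesMarked B M := by
  intro n τ q hc
  by_cases hq : A = ∅ ∨ ∀ i < n, q i ≠ p
  · refine h.cycle_marked ⟨hc.pos, hc.closed, fun i => Or.inr (hc.mem i), hc.post_pos, hc.pre_pos⟩
      fun i hi s hs hsq => ?_
    have hsB : s ∈ B := by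
      rcases hs with hs | hs
      · rcases hq with rfl | hq
        · exact hs.elim
        · rcases hsep (q i) (hq i hi) with hA | hA
          · have := (hA s hs).2
            omega
          · have := (hA _ (hc.mem i)).1
            have := hc.pre_pos i
            omega
      · exact hs
    exact hB.post_unique (q i) s hsB _ (hc.mem _) hsq (hc.post_pos i)
  · push Not at hq
    obtain ⟨hA, i, hi, hqi⟩ := hq
    rw [← hc.sum_eq hB hZ hM]
    refine Finset.sum_pos' (fun _ _ => Nat.zero_le _) ⟨i, Finset.mem_range.2 hi, ?_⟩
    rw [hqi]
    exact hp.resolve_left hA.ne_empty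

end Fintype

end PetriNet

/-! ### Gluing a marked graph at a single place. -/

namespace PetriNet

variable {P T : Type*} {N : PetriNet P T} {A B : Set T} {M M' M'' : P → ℕ}

/-- Tokens on places that are not adjacent to `A` do not matter for firing transitions of `A`. -/
lemma ReachVia.congr (h : N.ReachVia A M M') {L L' : P → ℕ} (hL : ∀ q, L q = M q ∨ N.Apart A q)
    (hL' : ∀ q, (L' q : ℤ) = L q + (M' q - M q)) : N.ReachVia A L L' := by
  induction h using Relation.ReflTransGen.head_induction_on generalizing L with
  | refl =>
    have : L' = L := funext fun q => by have := hL' q; omega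
    exact this ▸ Relation.ReflTransGen.refl
  | head hf _ ih =>
    obtain ⟨t, ht, hen, heq⟩ := hf
    have henL : N.Enabled L t := fun q => by
      rcases hL q with h | h
      · exact h ▸ hen q
      · simp [(h t ht).1]
    obtain ⟨L₁, hL₁⟩ := henL.exists_fires
    refine Relation.ReflTransGen.head ⟨t, ht, hL₁⟩ (ih (fun q => ?_) fun q => ?_)
    · refine (hL q).imp_left fun h => ?_
      have h1 := hL₁.2 q
      have h2 := heq q
      rw [h] at h1
      omega
    · have h1 := hL₁.2 q
      have h2 := heq q
      have h3 := hL' q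
      omega

section Fintype

variable [Fintype T]

/-- Integer firing counts of the transitions of `B` add a bounded number of tokens to `p` as long as all
other places stay nonnegative. -/
lemma IsBlock.exists_bound (hB : N.IsBlock B) (p : P) (M : P → ℕ) :
    ∃ c : ℤ, ∀ Z : T → ℤ, (∀ t ∉ B, Z t = 0) →
      (∀ q, q ≠ p → 0 ≤ (M q : ℤ) + N.incidence.mulVec Z q) → N.incidence.mulVec Z p ≤ c := by
  rcases hB.apart_or p with h | ⟨a, ha, b, hb, hap, hbp⟩
  · exact ⟨0, fun Z hZ _ => (h.mulVec_eq hZ).le⟩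
  · have key : a ∈ B ∧ ∃ c : ℤ, ∀ Z : T → ℤ, (∀ t ∉ B, Z t = 0) →
        (∀ q, q ≠ p → 0 ≤ (M q : ℤ) + N.incidence.mulVec Z q) → Z a ≤ Z b + c := by
      -- Along a path from the consumer `b` of `p` to its producer `a`, each place allows its target
      -- to fire at most `M q` times more than its source.
      refine Relation.ReflTransGen.rec ⟨hb, 0, fun Z _ _ => by simp⟩ ?_ (hB.connected b hb a ha)
      rintro s t - ⟨htB, q, hsq, htq⟩ ⟨hsB, c, hc⟩
      refine ⟨htB, ?_⟩
      -- Nonnegativity is not available at `p`, but a path through `p` is back at `b`, where the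
      -- estimate restarts with constant `0`.
      by_cases hq : q = p
      · subst hq
        obtain rfl := hB.pre_unique q t htB b hb htq hbp
        exact ⟨0, fun Z _ _ => by simp⟩
      · refine ⟨c + M q, fun Z hZ h => ?_⟩
        have h1 := h q hq
        have h2 := hc Z hZ h
        rw [hB.mulVec_eq hsB htB hsq htq hZ] at h1
        omega
    obtain ⟨-, c, hc⟩ := key
    refine ⟨c, fun Z hZ h => ?_⟩
    rw [hB.mulVec_eq ha hb hap hbp hZ]
    have := hc Z hZ h
    omega

/-- If nothing can be gained on `p`, the marking `M` is kept; otherwise the largest gain is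
positive, so `p` ends up marked. In the second case `LiveVia.cyclesMarked` makes the new marking
reachable. -/
lemma exists_maximal_of_bound (p : P) (M : P → ℕ)
    (h : ∃ c : ℤ, ∀ Z : T → ℤ, (∀ t ∉ B, Z t = 0) →
      (∀ q, q ≠ p → 0 ≤ (M q : ℤ) + N.incidence.mulVec Z q) → N.incidence.mulVec Z p ≤ c) :
    ∃ (M₁ : P → ℕ) (Y : T → ℤ), (∀ t ∉ B, Y t = 0) ∧
      (∀ q, (M₁ q : ℤ) = M q + N.incidence.mulVec Y q) ∧ (M₁ = M ∨ 0 < M₁ p) ∧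
      ∀ Z : T → ℤ, (∀ t ∉ B, Z t = 0) →
        (∀ q, q ≠ p → 0 ≤ (M₁ q : ℤ) + N.incidence.mulVec Z q) →
        N.incidence.mulVec Z p ≤ 0 := by
  obtain ⟨c, hc⟩ := h
  by_cases h0 : ∀ Z : T → ℤ, (∀ t ∉ B, Z t = 0) →
        (∀ q, q ≠ p → 0 ≤ (M q : ℤ) + N.incidence.mulVec Z q) → N.incidence.mulVec Z p ≤ 0
  · exact ⟨M, 0, fun _ _ => rfl, fun q => by simp, Or.inl rfl, h0⟩
  · push Not at h0
    obtain ⟨Z₀, hZ₀, hM₀, hp₀⟩ := h0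
    obtain ⟨x, ⟨Y, hY, hMY, rfl⟩, hx⟩ := Int.exists_greatest_of_bdd
      (P := fun x => ∃ Z : T → ℤ, (∀ t ∉ B, Z t = 0) ∧
        (∀ q, q ≠ p → 0 ≤ (M q : ℤ) + N.incidence.mulVec Z q) ∧ N.incidence.mulVec Z p = x)
      ⟨c, by rintro _ ⟨Z, h1, h2, rfl⟩; exact hc Z h1 h2⟩ ⟨_, Z₀, hZ₀, hM₀, rfl⟩
    have hpos : 0 < N.incidence.mulVec Y p := hp₀.trans_le (hx _ ⟨Z₀, hZ₀, hM₀, rfl⟩)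
    obtain ⟨M₁, hM₁⟩ := exists_marking (N := N) (M := M) (Y := Y) fun q => by
      by_cases hq : q = p
      · subst hq
        omega
      · exact hMY q hq
    refine ⟨M₁, Y, hY, hM₁, Or.inr ?_, fun Z hZ h => ?_⟩
    · have := hM₁ p
      omega
    · have := hx _ ⟨Y + Z, fun t ht => by simp [hY t ht, hZ t ht], fun q hq => ?_, rfl⟩
      · rw [Matrix.mulVec_add, Pi.add_apply] at this
        omega
      · have h1 := h q hq
        rw [Matrix.mulVec_add, Pi.add_apply]
        rw [hM₁ q] at h1
        omega

/-- If `B` can put no more tokens on the only place `p` that it shares with `A`, then `A` does not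
need `B` in order to stay live. -/
lemma LiveVia.of_maximal (p : P) (hsep : ∀ q, q ≠ p → N.Apart A q ∨ N.Apart B q)
    (h : N.LiveVia (A ∪ B) M)
    (hmax : ∀ Z : T → ℤ, (∀ t ∉ B, Z t = 0) →
      (∀ q, q ≠ p → 0 ≤ (M q : ℤ) + N.incidence.mulVec Z q) → N.incidence.mulVec Z p ≤ 0) :
    N.LiveVia A M := by
  classical
  intro t ht X hX
  -- Omitting the firings of `B`, recorded in `Z`, does not disable `A`: by maximality they bring no
  -- net gain to `p`, and they do not affect the other places adjacent to `A`.
  have key : ∀ {X' X'' : P → ℕ} {Z : T → ℤ}, N.ReachVia A M X'' → (∀ t ∉ B, Z t = 0) →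
      (∀ q, (X' q : ℤ) = X'' q + N.incidence.mulVec Z q) → ∀ s ∈ A, N.Enabled X' s →
      N.Enabled X'' s := by
    intro X' X'' Z hX'' hZ hX' s hs hen q
    by_cases hq : q = p
    · subst hq
      obtain ⟨Y, hY, hMY⟩ := hX''.exists_mulVec
      -- Away from `p`, a place adjacent to `B` is untouched by `A`, so `X''` agrees there with `M`
      -- and the maximality at `M` applies.
      have h1 := hmax Z hZ fun r hr => by
        rcases hsep r hr with hA | hA
        · have h1 := hX' r
          have h2 := hMY r
          rw [hA.mulVec_eq hY] at h2
          omega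
        · rw [hA.mulVec_eq hZ]
          omega
      have h2 := hX' q
      have h3 := hen q
      omega
    · rcases hsep q hq with hA | hA
      · simp [(hA s hs).1]
      · have h1 := hX' q
        rw [hA.mulVec_eq hZ] at h1
        have h2 := hen q
        omega
  -- A run of `A ∪ B` is simulated by its `A`-transitions alone.
  have sim : ∀ X', N.ReachVia (A ∪ B) X X' → ∃ X'', N.ReachVia A X X'' ∧ ∃ Z : T → ℤ,
      (∀ t ∉ B, Z t = 0) ∧ ∀ q, (X' q : ℤ) = X'' q + N.incidence.mulVec Z q := by
    intro X' hX'
    induction hX' with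
    | refl => exact ⟨X, Relation.ReflTransGen.refl, 0, fun _ _ => rfl, fun q => by simp⟩
    | tail _ hf ih =>
      obtain ⟨X'', hX'', Z, hZ, hXZ⟩ := ih
      obtain ⟨s, hs, hen, heq⟩ := hf
      by_cases hsA : s ∈ A
      · obtain ⟨X₁, hX₁⟩ := (key (hX.trans hX'') hZ hXZ s hsA hen).exists_fires
        refine ⟨X₁, Relation.ReflTransGen.tail hX'' ⟨s, hsA, hX₁⟩, Z, hZ, fun q => ?_⟩
        rw [heq q, hX₁.2 q, hXZ q]
        ring
      · have hsB := hs.resolve_left hsA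
        refine ⟨X'', hX'', Z + Pi.single s 1, fun u hu => ?_, fun q => ?_⟩
        · have : u ≠ s := fun h => hu (h ▸ hsB)
          simp [hZ u hu, this]
        · rw [Matrix.mulVec_add, Pi.add_apply, mulVec_single_one_apply, heq q, hXZ q, add_assoc]
  obtain ⟨X', hX', hen⟩ := h t (Or.inl ht) X (hX.mono Set.subset_union_left)
  obtain ⟨X'', hX'', Z, hZ, hXZ⟩ := sim X' hX'
  exact ⟨X'', hX'', key (hX.trans hX'') hZ hXZ t ht hen⟩

lemma PRRVia.empty (N : PetriNet P T) : N.PRRVia ∅ := fun M _ Y hY M' hM' => by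
  obtain rfl : Y = 0 := funext fun t => hY t (Set.notMem_empty t)
  obtain rfl : M' = M := funext fun q => by simpa using hM' q
  exact Relation.ReflTransGen.refl

/-- Gluing a marked graph `B` at a single place `p` preserves the equality of reachability and
potential reachability. -/
theorem PRRVia.union (hA : N.PRRVia A) (hB : N.IsBlock B) (p : P)
    (hsep : ∀ q, q ≠ p → N.Apart A q ∨ N.Apart B q) (hAp : A = ∅ ∨ ∃ t ∈ A, 0 < N.pre p t) :
    N.PRRVia (A ∪ B) := by
  classical
  intro M hM Y hY M' hM'
  by_cases hA0 : A = ∅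
  · have hYB : ∀ t ∉ B, Y t = 0 := fun t ht => hY t (by simp [hA0, ht])
    exact (hB.reachVia (hM.cyclesMarked hB p hsep hYB hM' (Or.inl hA0)) hYB hM').mono
      Set.subset_union_right
  obtain ⟨t, htA, htp⟩ := hAp.resolve_left hA0
  obtain ⟨M₁, Y₀, hY₀, hM₁, hM₁p, hmax⟩ :=
    exists_maximal_of_bound (B := B) p M (hB.exists_bound p M)
  have r₁ : N.ReachVia B M M₁ := by
    rcases hM₁p with rfl | hp
    · exact Relation.ReflTransGen.refl
    · exact hB.reachVia (hM.cyclesMarked hB p hsep hY₀ hM₁ (Or.inr hp)) hY₀ hM₁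
  have live₁ := hM.of_reachVia (r₁.mono Set.subset_union_right)
  have liveA := live₁.of_maximal p hsep hmax
  set YA : T → ℤ := fun t => if t ∈ A then Y t else 0 with hYAdef
  have hYA : ∀ t ∉ A, YA t = 0 := fun t ht => by simp [hYAdef, ht]
  -- The firings of `B` that remain after those already spent on filling `p`.
  set W : T → ℤ := Y - YA - Y₀ with hW
  have hWB : ∀ t ∉ B, W t = 0 := fun t ht => by
    by_cases htA : t ∈ A
    · simp [hW, hYAdef, htA, hY₀ t ht]
    · simp [hW, hYAdef, htA, hY₀ t ht, hY t (by simp [ht, htA])]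
  have hsplit : ∀ q, (M' q : ℤ) = M₁ q + N.incidence.mulVec YA q + N.incidence.mulVec W q := by
    intro q
    rw [hW, hM' q, hM₁ q, Matrix.mulVec_sub, Matrix.mulVec_sub, Pi.sub_apply, Pi.sub_apply]
    ring
  have hWp : N.incidence.mulVec W p ≤ 0 := hmax W hWB fun q hq => by
    rcases hsep q hq with h | h
    · have := hsplit q
      rw [h.mulVec_eq hYA] at this
      omega
    · rw [h.mulVec_eq hWB]
      omega
  obtain ⟨M₂, hM₂⟩ := exists_marking (N := N) (M := M₁) (Y := YA) fun q => by
    by_cases hq : q = p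
    · subst hq
      have := hsplit q
      omega
    · rcases hsep q hq with h | h
      · rw [h.mulVec_eq hYA]
        omega
      · have := hsplit q
        rw [h.mulVec_eq hWB] at this
        omega
  have r₂ : N.ReachVia A M₁ M₂ := hA M₁ liveA YA hYA M₂ hM₂
  have hM₂' : ∀ q, (M' q : ℤ) = M₂ q + N.incidence.mulVec W q := fun q => by
    rw [hsplit q, hM₂ q]
  have live₂ := live₁.of_reachVia (r₂.mono Set.subset_union_left)
  refine (r₁.mono Set.subset_union_right).trans ((r₂.mono Set.subset_union_left).trans ?_)
  have hcyc : ∀ {X : P → ℕ}, N.LiveVia (A ∪ B) X → 0 < X p → N.CyclesMarked B X :=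
    fun hX hXp => hX.cyclesMarked hB p hsep (Z := 0) (fun _ _ => rfl) (fun q => by simp)
      (Or.inr hXp)
  -- With `p` empty, the cycles of `B` through `p` may fail the criterion, so a token has to be
  -- borrowed from `A`.
  rcases Nat.eq_zero_or_pos (M₂ p) with hp | hp
  · have hWp0 : N.incidence.mulVec W p = 0 := by
      have := hM₂' p
      omega
    have live₂A := liveA.of_reachVia r₂
    obtain ⟨X, hX, hen⟩ := live₂A t htA M₂ Relation.ReflTransGen.refl
    have hXp : 0 < X p := htp.trans_le (hen p)
    obtain ⟨Y₂, hY₂, hXY⟩ := hX.exists_mulVec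
    -- The detour of `A` is undone by applying the invariant to the negated counts.
    have hback : N.ReachVia A X M₂ := hA X (live₂A.of_reachVia hX) (-Y₂)
      (fun t ht => by simp [hY₂ t ht]) M₂ fun q => by
        rw [Matrix.mulVec_neg, Pi.neg_apply, hXY q]
        ring
    have hfix : ∀ q, N.incidence.mulVec W q = 0 ∨ N.Apart A q := fun q => by
      by_cases hq : q = p
      · exact Or.inl (hq ▸ hWp0)
      · exact (hsep q hq).symm.imp_left fun h => h.mulVec_eq hWB
    obtain ⟨X₂, hX₂⟩ := exists_marking (N := N) (M := X) (Y := W) fun q => by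
      rcases hfix q with h | h
      · omega
      · have h1 := hXY q
        have h2 := hM₂' q
        rw [h.mulVec_eq hY₂] at h1
        omega
    have live₃ := live₂.of_reachVia (hX.mono Set.subset_union_left)
    have r₃ : N.ReachVia B X X₂ := hB.reachVia (hcyc live₃ hXp) hWB hX₂
    -- Since `W` has no effect on `p`, the markings `X₂` and `X` differ only on places that `A` does
    -- not touch, so the way back still works.
    have r₄ : N.ReachVia A X₂ M' := hback.congr
      (fun q => (hfix q).imp_left fun h => by have := hX₂ q; omega) fun q => by
        rw [hM₂' q, hX₂ q]
        ring
    exact (hX.mono Set.subset_union_left).trans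
      ((r₃.mono Set.subset_union_right).trans (r₄.mono Set.subset_union_left))
  · exact (hB.reachVia (hcyc live₂ hp) hWB hM₂').mono Set.subset_union_right

end Fintype

end PetriNet

/-! ### Components, firing sequences and reversal. -/

namespace PetriNet

variable {P T : Type*} {N : PetriNet P T}

lemma componentOf_eq_of_pre_pos {p : P} {t : T} (h : 0 < N.pre p t) :
    N.componentOf (Sum.inl p) = N.componentOf (Sum.inr t) := by
  refine SimpleGraph.ConnectedComponent.connectedComponentMk_eq_of_adj ?_
  rw [underlyingGraph, SimpleGraph.fromRel_adj]
  exact ⟨Sum.inl_ne_inr, Or.inl h⟩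

lemma componentOf_eq_of_post_pos {p : P} {t : T} (h : 0 < N.post t p) :
    N.componentOf (Sum.inl p) = N.componentOf (Sum.inr t) := by
  refine SimpleGraph.ConnectedComponent.connectedComponentMk_eq_of_adj ?_
  rw [underlyingGraph, SimpleGraph.fromRel_adj]
  exact ⟨Sum.inl_ne_inr, Or.inr h⟩

/-- Directed paths alternate between places and transitions; a path ending at a place is remembered
by the last transition before it. -/
lemma StronglyConnected.reflTransGen (h : N.StronglyConnected) (s t : T) :
    Relation.ReflTransGen (fun s t => ∃ q, 0 < N.post s q ∧ 0 < N.pre q t) s t := by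
  have key : ∀ y, Relation.ReflTransGen N.Arc (Sum.inr s) y → Sum.elim
      (fun p => ∃ u, Relation.ReflTransGen (fun s t => ∃ q, 0 < N.post s q ∧ 0 < N.pre q t) s u ∧
        0 < N.post u p)
      (fun t => Relation.ReflTransGen (fun s t => ∃ q, 0 < N.post s q ∧ 0 < N.pre q t) s t) y := by
    intro y hy
    induction hy with
    | refl => exact Relation.ReflTransGen.refl
    | @tail b c _ hbc ih =>
      rcases b with p | u <;> rcases c with p' | u'
      · exact hbc.elim
      · obtain ⟨v, hv, hvp⟩ := ih
        exact hv.tail ⟨p, hvp, hbc⟩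
      · exact ⟨u, ih, hbc⟩
      · exact hbc.elim
  exact key _ (h (Sum.inr s) (Sum.inr t))

lemma firesSeq_iff_reachVia {M M' : P → ℕ} :
    (∃ σ, N.FiresSeq M σ M') ↔ N.ReachVia Set.univ M M' := by
  constructor
  · rintro ⟨σ, h⟩
    induction σ generalizing M with
    | nil =>
      obtain rfl : M' = M := h
      exact Relation.ReflTransGen.refl
    | cons t σ ih =>
      obtain ⟨M₁, h₁, h₂⟩ := h
      exact Relation.ReflTransGen.head ⟨t, trivial, h₁⟩ (ih h₂)
  · intro h
    induction h using Relation.ReflTransGen.head_induction_on with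
    | refl => exact ⟨[], rfl⟩
    | head hf _ ih =>
      obtain ⟨t, -, hf⟩ := hf
      obtain ⟨σ, hσ⟩ := ih
      exact ⟨t :: σ, _, hf, hσ⟩

lemma Fires.reverse {M M' : P → ℕ} {t : T} (h : N.reverse.Fires M t M') : N.Fires M' t M := by
  refine ⟨fun p => ?_, fun p => ?_⟩ <;>
  · have h1 := h.1 p
    have h2 := h.2 p
    simp only [PetriNet.reverse, incidence] at h1 h2 ⊢
    omega

lemma ReachVia.reverse {A : Set T} {M M' : P → ℕ} (h : N.reverse.ReachVia A M M') :
    N.ReachVia A M' M := by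
  induction h with
  | refl => exact Relation.ReflTransGen.refl
  | tail _ hf ih =>
    obtain ⟨t, ht, hf⟩ := hf
    exact Relation.ReflTransGen.head ⟨t, ht, hf.reverse⟩ ih

end PetriNet

/-! ### From the invariant to property R and the PR-R equality. -/

namespace PetriSystem

variable {P T : Type*} {N : PetriNet P T} {M M' : P → ℕ}

lemma mem_reach : M' ∈ reach ⟨N, M⟩ ↔ N.ReachVia Set.univ M M' :=
  PetriNet.firesSeq_iff_reachVia

lemma Live.liveVia (h : Live ⟨N, M⟩) : N.LiveVia Set.univ M := by
  intro t _ M' hM'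
  obtain ⟨X, hX, hen⟩ := h t M' (mem_reach.2 hM')
  exact ⟨X, mem_reach.1 hX, hen⟩

theorem propertyR_and_PRREquality [Fintype T] (hN : N.PRRVia Set.univ)
    (h : Live ⟨N, M⟩) : PropertyR ⟨N, M⟩ ∧ PRREquality ⟨N, M⟩ := by
  have hl := h.liveVia
  refine ⟨⟨fun X hX => ?_, fun X hX => ?_⟩, Set.ext fun X => ⟨fun hX => ?_, ?_⟩⟩
  · replace hX := mem_reach.1 hX
    obtain ⟨Y, -, hY⟩ := hX.exists_mulVec
    refine mem_reach.2 (hN X (hl.of_reachVia hX) (-Y) (by simp) M fun q => ?_)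
    rw [Matrix.mulVec_neg, Pi.neg_apply, hY q]
    ring
  -- A run of the reverse net is a run of the net from `X` back to the live marking `M`; negating
  -- its counts gives a run from `M` to `X`, which is then read backwards.
  · have hX' : N.ReachVia Set.univ X M := (mem_reach.1 hX).reverse
    obtain ⟨Y, -, hY⟩ := hX'.exists_mulVec
    have hr : N.ReachVia Set.univ M X := hN M hl (-Y) (by simp) X fun q => by
      rw [Matrix.mulVec_neg, Pi.neg_apply, hY q]
      ring
    exact mem_reach.2 (PetriNet.ReachVia.reverse (N := N.reverse) hr)
  -- The counts must be natural numbers here, so they are collected from the sequence itself.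
  · obtain ⟨σ, hσ⟩ := hX
    change N.FiresSeq M σ X at hσ
    clear h hl
    induction σ generalizing M with
    | nil =>
      obtain rfl : X = M := hσ
      exact ⟨0, fun p => by simp [Matrix.mulVec, dotProduct]⟩
    | cons t σ ih =>
      classical
      obtain ⟨M₁, h₁, h₂⟩ := hσ
      obtain ⟨Y, hY⟩ := ih h₂
      refine ⟨Y + Pi.single t 1, fun p => ?_⟩
      have : (fun s => (((Y + Pi.single t 1 : T → ℕ) s : ℕ) : ℤ)) =
          (fun s => (Y s : ℤ)) + Pi.single t 1 := by
        funext s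
        by_cases hs : s = t
        · subst hs; simp
        · simp [hs]
      rw [this, Matrix.mulVec_add, Pi.add_apply]
      have h3 := PetriNet.mulVec_single_one_apply N t p
      have h4 := hY p
      have h5 := h₁.2 p
      simp only at h4 ⊢
      omega
  · rintro ⟨Y, hY⟩
    exact mem_reach.2 (hN M hl _ (by simp) X hY)

end PetriSystem

/-! ### The composed net and induction along the tree. -/

namespace PCMGLe

variable {V P T : Type*} {G : SimpleGraph V} [Fintype P]

/-- The places of the base net that are merged into the place `q`. -/
noncomputable def members (C : PCMGLe G P T) : C.Place → Finset P
  | Sum.inl x => x.1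
  | Sum.inr p => {p.1}

/-- The edge of `G` whose component contains the transition `t`. -/
noncomputable def edgeOf (C : PCMGLe G P T) (t : T) : Sym2 V :=
  (C.β.symm (C.base.componentOf (Sum.inr t))).1

/-- The place into which the places associated to the vertex `v` are merged. -/
noncomputable def vertexPlace (C : PCMGLe G P T) (v : V) : C.Place := Sum.inl ⟨C.block v, v, rfl⟩

variable (C : PCMGLe G P T)

lemma net_pre (q : C.Place) (t : T) : C.net.pre q t = ∑ p ∈ C.members q, C.base.pre p t := by
  rcases q with x | p <;> simp [net, PetriNet.placeMerge, members]

lemma net_post (q : C.Place) (t : T) : C.net.post t q = ∑ p ∈ C.members q, C.base.post t p := by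
  rcases q with x | p <;> simp [net, PetriNet.placeMerge, members]

lemma net_pre_pos {q : C.Place} {t : T} :
    0 < C.net.pre q t ↔ ∃ p ∈ C.members q, 0 < C.base.pre p t := by
  simp [net_pre, Nat.pos_iff_ne_zero]

lemma net_post_pos {q : C.Place} {t : T} :
    0 < C.net.post t q ↔ ∃ p ∈ C.members q, 0 < C.base.post t p := by
  simp [net_post, Nat.pos_iff_ne_zero]

lemma mem_block {v : V} {p : P} : p ∈ C.block v ↔ ∃ d : G.Dart, d.fst = v ∧ C.γ d = p := by
  simp [block]

lemma exists_mem_members (p : P) : ∃ q, p ∈ C.members q := by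
  by_cases h : ∃ x ∈ Set.range C.block, p ∈ x
  · obtain ⟨x, hx, hp⟩ := h
    exact ⟨Sum.inl ⟨x, hx⟩, hp⟩
  · push Not at h
    exact ⟨Sum.inr ⟨p, h⟩, Finset.mem_singleton_self p⟩

/-- Merging never identifies two places of one component: the two orientations of an edge start at
different vertices. Hence each component survives in the composed net as a marked graph with unit
weights. -/
lemma members_unique {q : C.Place} {p p' : P} (hp : p ∈ C.members q) (hp' : p' ∈ C.members q)
    (h : C.base.componentOf (Sum.inl p) = C.base.componentOf (Sum.inl p')) : p = p' := by
  rcases q with ⟨_, v, rfl⟩ | r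
  · obtain ⟨d, hd, rfl⟩ := C.mem_block.1 hp
    obtain ⟨d', hd', rfl⟩ := C.mem_block.1 hp'
    rw [C.γ_mem, C.γ_mem] at h
    have he : d.edge = d'.edge := congrArg Subtype.val (C.β.injective h)
    rcases SimpleGraph.dart_edge_eq_iff d d' |>.1 he with rfl | rfl
    · rfl
    · exact absurd (hd.trans hd'.symm) d'.adj.ne'
  · rw [Finset.mem_singleton.1 hp, Finset.mem_singleton.1 hp']

lemma net_pre_eq {q : C.Place} {p : P} {t : T} (hp : p ∈ C.members q)
    (h : C.base.componentOf (Sum.inl p) = C.base.componentOf (Sum.inr t)) :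
    C.net.pre q t = C.base.pre p t := by
  rw [net_pre, Finset.sum_eq_single_of_mem p hp]
  intro p' hp' hne
  by_contra h0
  exact hne (C.members_unique hp' hp
    ((PetriNet.componentOf_eq_of_pre_pos (Nat.pos_of_ne_zero h0)).trans h.symm))

lemma net_post_eq {q : C.Place} {p : P} {t : T} (hp : p ∈ C.members q)
    (h : C.base.componentOf (Sum.inl p) = C.base.componentOf (Sum.inr t)) :
    C.net.post t q = C.base.post t p := by
  rw [net_post, Finset.sum_eq_single_of_mem p hp]
  intro p' hp' hne
  by_contra h0
  exact hne (C.members_unique hp' hp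
    ((PetriNet.componentOf_eq_of_post_pos (Nat.pos_of_ne_zero h0)).trans h.symm))

omit [Fintype P] in
lemma edgeOf_eq_of_mem {t : T} {d : G.Dart}
    (h : C.base.componentOf (Sum.inl (C.γ d)) = C.base.componentOf (Sum.inr t)) :
    C.edgeOf t = d.edge := by
  rw [edgeOf, ← h, C.γ_mem, Equiv.symm_apply_apply]

variable {C}

omit [Fintype P] in
lemma WellStructured.exists_pre (hC : C.WellStructured) (p : P) : ∃ t, 0 < C.base.pre p t := by
  have h := ((hC (C.base.componentOf (Sum.inl p))).2.2.2 ⟨p, rfl⟩).2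
  obtain ⟨t, ht⟩ := Set.encard_eq_one.1 h
  have : t ∈ ({t} : Set _) := rfl
  rw [← ht] at this
  exact ⟨t.1, this⟩

omit [Fintype P] in
lemma WellStructured.exists_post (hC : C.WellStructured) (p : P) : ∃ t, 0 < C.base.post t p := by
  have h := ((hC (C.base.componentOf (Sum.inl p))).2.2.2 ⟨p, rfl⟩).1
  obtain ⟨t, ht⟩ := Set.encard_eq_one.1 h
  have : t ∈ ({t} : Set _) := rfl
  rw [← ht] at this
  exact ⟨t.1, this⟩

lemma WellStructured.isBlock (hC : C.WellStructured) (c : C.base.Component) :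
    C.net.IsBlock {t | C.base.componentOf (Sum.inr t) = c} := by
  have hpre : ∀ {q : C.Place} {t : T}, 0 < C.net.pre q t → ∃ p ∈ C.members q,
      C.base.componentOf (Sum.inl p) = C.base.componentOf (Sum.inr t) ∧ 0 < C.base.pre p t :=
    fun h => by
      obtain ⟨p, hp, h⟩ := C.net_pre_pos.1 h
      exact ⟨p, hp, PetriNet.componentOf_eq_of_pre_pos h, h⟩
  have hpost : ∀ {q : C.Place} {t : T}, 0 < C.net.post t q → ∃ p ∈ C.members q,
      C.base.componentOf (Sum.inl p) = C.base.componentOf (Sum.inr t) ∧ 0 < C.base.post t p :=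
    fun h => by
      obtain ⟨p, hp, h⟩ := C.net_post_pos.1 h
      exact ⟨p, hp, PetriNet.componentOf_eq_of_post_pos h, h⟩
  refine ⟨fun q t ht => ?_, fun q t ht => ?_, fun q s hs t ht hqs hqt => ?_,
    fun q s hs t ht hqs hqt => ?_, fun q => ⟨?_, ?_⟩, fun s hs t ht => ?_⟩
  · by_contra h
    obtain ⟨p, hp, hpt, -⟩ := hpre (q := q) (t := t) (by omega)
    have := (C.base_isMGLe.1 p t).1
    rw [C.net_pre_eq hp hpt] at h
    exact h this
  · by_contra h
    obtain ⟨p, hp, hpt, -⟩ := hpost (q := q) (t := t) (by omega)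
    have := (C.base_isMGLe.1 p t).2
    rw [C.net_post_eq hp hpt] at h
    exact h this
  · obtain ⟨p, hp, hps, h1⟩ := hpre hqs
    obtain ⟨p', hp', hpt, h2⟩ := hpre hqt
    obtain rfl := C.members_unique hp hp' (by rw [hps, hpt, hs.trans ht.symm])
    exact Set.encard_le_one_iff.1 (C.base_isMGLe.2 p).2 s t h1 h2
  · obtain ⟨p, hp, hps, h1⟩ := hpost hqs
    obtain ⟨p', hp', hpt, h2⟩ := hpost hqt
    obtain rfl := C.members_unique hp hp' (by rw [hps, hpt, hs.trans ht.symm])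
    exact Set.encard_le_one_iff.1 (C.base_isMGLe.2 p).1 s t h1 h2
  · rintro ⟨t, ht, h⟩
    obtain ⟨p, hp, hpt, -⟩ := hpre h
    obtain ⟨s, hs⟩ := hC.exists_post p
    exact ⟨s, (PetriNet.componentOf_eq_of_post_pos hs).symm.trans (hpt.trans ht),
      C.net_post_pos.2 ⟨p, hp, hs⟩⟩
  · rintro ⟨t, ht, h⟩
    obtain ⟨p, hp, hpt, -⟩ := hpost h
    obtain ⟨s, hs⟩ := hC.exists_pre p
    exact ⟨s, (PetriNet.componentOf_eq_of_pre_pos hs).symm.trans (hpt.trans ht),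
      C.net_pre_pos.2 ⟨p, hp, hs⟩⟩
  · refine Relation.ReflTransGen.lift (fun t : {t : T // C.base.componentOf (Sum.inr t) = c} => t.1)
      ?_ _ _ ((hC c).1.reflTransGen ⟨s, hs⟩ ⟨t, ht⟩)
    rintro u v ⟨p, hu, hv⟩
    obtain ⟨q, hq⟩ := C.exists_mem_members p.1
    exact ⟨v.2, q, C.net_post_pos.2 ⟨p.1, hq, hu⟩, C.net_pre_pos.2 ⟨p.1, hq, hv⟩⟩

/-- The transitions whose edge joins two vertices of `U`. -/
def transitionsIn (C : PCMGLe G P T) (U : Set V) : Set T := {t | ∀ v ∈ C.edgeOf t, v ∈ U}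

omit [Fintype P] in
lemma edgeOf_mem (C : PCMGLe G P T) (t : T) : C.edgeOf t ∈ G.edgeSet :=
  (C.β.symm (C.base.componentOf (Sum.inr t))).2

omit [Fintype P] in
lemma mem_component_iff {e : G.edgeSet} {t : T} :
    C.base.componentOf (Sum.inr t) = C.β e ↔ C.edgeOf t = e.1 := by
  rw [edgeOf, ← Subtype.ext_iff, Equiv.symm_apply_eq]

/-- A place adjacent to transitions of two different components is the place of a common vertex. -/
lemma exists_eq_vertexPlace {q : C.Place} {s t : T} (hst : C.edgeOf s ≠ C.edgeOf t)
    (hs : C.net.pre q s ≠ 0 ∨ C.net.post s q ≠ 0) (ht : C.net.pre q t ≠ 0 ∨ C.net.post t q ≠ 0) :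
    ∃ v, q = C.vertexPlace v ∧ v ∈ C.edgeOf s ∧ v ∈ C.edgeOf t := by
  have key : ∀ {t : T}, C.net.pre q t ≠ 0 ∨ C.net.post t q ≠ 0 → ∃ p ∈ C.members q,
      C.base.componentOf (Sum.inl p) = C.base.componentOf (Sum.inr t) := by
    rintro t (h | h)
    · obtain ⟨p, hp, h⟩ := C.net_pre_pos.1 (Nat.pos_of_ne_zero h)
      exact ⟨p, hp, PetriNet.componentOf_eq_of_pre_pos h⟩
    · obtain ⟨p, hp, h⟩ := C.net_post_pos.1 (Nat.pos_of_ne_zero h)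
      exact ⟨p, hp, PetriNet.componentOf_eq_of_post_pos h⟩
  obtain ⟨p, hp, hps⟩ := key hs
  obtain ⟨p', hp', hpt⟩ := key ht
  rcases q with ⟨_, v, rfl⟩ | r
  · refine ⟨v, rfl, ?_, ?_⟩
    · obtain ⟨d, hd, rfl⟩ := C.mem_block.1 hp
      rw [C.edgeOf_eq_of_mem hps, ← hd]
      exact Sym2.mem_mk_left _ _
    · obtain ⟨d, hd, rfl⟩ := C.mem_block.1 hp'
      rw [C.edgeOf_eq_of_mem hpt, ← hd]
      exact Sym2.mem_mk_left _ _
  · refine absurd ?_ hst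
    obtain rfl := (Finset.mem_singleton.1 hp).trans (Finset.mem_singleton.1 hp').symm
    rw [edgeOf, edgeOf, ← hps, ← hpt]

lemma WellStructured.exists_pre_vertexPlace (hC : C.WellStructured) (d : G.Dart) :
    ∃ t, C.edgeOf t = d.edge ∧ 0 < C.net.pre (C.vertexPlace d.fst) t := by
  obtain ⟨t, ht⟩ := hC.exists_pre (C.γ d)
  exact ⟨t, C.edgeOf_eq_of_mem (PetriNet.componentOf_eq_of_pre_pos ht),
    C.net_pre_pos.2 ⟨C.γ d, C.mem_block.2 ⟨d, rfl, rfl⟩, ht⟩⟩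

/-- In a forest, the edge from `v` to `w` is a bridge; a second neighbour `v'` of `w` in `U` would
give a detour from `v` through `U` to `v'` and on to `w`. -/
lemma _root_.SimpleGraph.IsAcyclic.eq_of_adj_of_preconnected (hG : G.IsAcyclic) {U : Set V}
    (hU : (G.induce U).Preconnected) {v v' w : V} (hv : v ∈ U) (hv' : v' ∈ U) (hw : w ∉ U)
    (h : G.Adj v w) (h' : G.Adj v' w) : v = v' := by
  by_contra hne
  have hb := SimpleGraph.isAcyclic_iff_forall_adj_isBridge.1 hG h
  rw [SimpleGraph.isBridge_iff] at hb
  refine hb ?_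
  have hmem : ∀ {x y : V}, y ≠ w → x ≠ w → s(x, y) ∉ ({s(v, w)} : Set (Sym2 V)) := by
    intro x y hy hx h
    have : w ∈ s(x, y) := Set.mem_singleton_iff.1 h ▸ Sym2.mem_mk_right v w
    rcases Sym2.mem_iff.1 this with rfl | rfl
    · exact hx rfl
    · exact hy rfl
  have hUw : ∀ x : U, x.1 ≠ w := fun x h => hw (h ▸ x.2)
  let φ : G.induce U →g G.deleteEdges {s(v, w)} :=
    ⟨Subtype.val, fun {x y} hxy =>
      SimpleGraph.deleteEdges_adj.2 ⟨hxy, hmem (hUw y) (hUw x)⟩⟩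
  refine ((hU ⟨v, hv⟩ ⟨v', hv'⟩).map φ).trans (SimpleGraph.Adj.reachable ?_)
  refine SimpleGraph.deleteEdges_adj.2 ⟨h', fun he => ?_⟩
  rcases Sym2.eq_iff.1 (Set.mem_singleton_iff.1 he) with ⟨h1, -⟩ | ⟨h1, -⟩
  · exact hne h1.symm
  · exact hw (h1 ▸ hv')

/-- The vertex `w` is joined to `U` by the single edge to `v`, so exactly one component is added. It
meets the old part only in the place of `v`, because a shared place belongs to a common endpoint and
`w` lies outside `U`. -/
theorem WellStructured.prrVia_transitionsIn_insert [Fintype T] (hC : C.WellStructured)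
    (hG : G.IsAcyclic) {U : Set V} (hU : (G.induce U).Preconnected)
    (h : C.net.PRRVia (C.transitionsIn U)) {v w : V} (hv : v ∈ U) (hw : w ∉ U) (hvw : G.Adj v w) :
    C.net.PRRVia (C.transitionsIn (insert w U)) := by
  have hEq : C.transitionsIn (insert w U) = C.transitionsIn U ∪
      {t | C.base.componentOf (Sum.inr t) = C.β ⟨s(v, w), hvw⟩} := by
    ext t
    simp only [Set.mem_union, Set.mem_ofPred_eq, mem_component_iff, transitionsIn]
    have ht := C.edgeOf_mem t
    generalize C.edgeOf t = e at ht ⊢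
    induction e using Sym2.ind with
    | _ a b =>
    rw [SimpleGraph.mem_edgeSet] at ht
    simp only [Sym2.mem_iff, forall_eq_or_imp, forall_eq, Set.mem_insert_iff]
    constructor
    · rintro ⟨rfl | ha, rfl | hb⟩
      · exact (ht.ne rfl).elim
      · right
        rw [hG.eq_of_adj_of_preconnected hU hv hb hw hvw ht.symm, Sym2.eq_swap]
      · right
        rw [hG.eq_of_adj_of_preconnected hU hv ha hw hvw ht]
      · exact Or.inl ⟨ha, hb⟩
    · rintro (⟨ha, hb⟩ | h)
      · exact ⟨Or.inr ha, Or.inr hb⟩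
      · rcases Sym2.eq_iff.1 h with ⟨rfl, rfl⟩ | ⟨rfl, rfl⟩
        · exact ⟨Or.inr hv, Or.inl rfl⟩
        · exact ⟨Or.inl rfl, Or.inr hv⟩
  rw [hEq]
  refine h.union (hC.isBlock _) (C.vertexPlace v) (fun q hq => ?_) ?_
  · by_contra hcon
    simp only [PetriNet.Apart, not_or, not_forall, not_and_or] at hcon
    obtain ⟨⟨s, hs, hqs⟩, t, ht, hqt⟩ := hcon
    have hte : C.edgeOf t = s(v, w) := mem_component_iff.1 ht
    have hst : C.edgeOf s ≠ C.edgeOf t := fun he =>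
      hw (hs w (he ▸ hte ▸ Sym2.mem_mk_right v w))
    obtain ⟨u, rfl, hus, hut⟩ := exists_eq_vertexPlace hst hqs hqt
    rw [hte, Sym2.mem_iff] at hut
    rcases hut with rfl | rfl
    · exact hq rfl
    · exact hw (hs u hus)
  -- An edge at `v` inside `U` supplies an old transition consuming from the shared place. Without
  -- such an edge, connectedness leaves `U` with only the vertex `v`, hence with no transitions.
  · by_cases hU' : ∃ v' ∈ U, G.Adj v v'
    · obtain ⟨v', hv', hadj⟩ := hU'
      obtain ⟨t, ht, hpos⟩ := hC.exists_pre_vertexPlace (⟨(v, v'), hadj⟩ : G.Dart)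
      refine Or.inr ⟨t, fun x hx => ?_, hpos⟩
      rw [ht] at hx
      rcases Sym2.mem_iff.1 hx with rfl | rfl
      · exact hv
      · exact hv'
    · left
      refine Set.eq_empty_iff_forall_notMem.2 fun t ht => ?_
      have hte := C.edgeOf_mem t
      simp only [transitionsIn, Set.mem_ofPred_eq] at ht
      generalize C.edgeOf t = e at ht hte
      induction e using Sym2.ind with
      | _ a b =>
      have ha := ht a (Sym2.mem_mk_left a b)
      have hb := ht b (Sym2.mem_mk_right a b)
      have : Nontrivial U := ⟨⟨a, ha⟩, ⟨b, hb⟩, fun h => hte.ne (congrArg Subtype.val h)⟩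
      obtain ⟨v', hv'⟩ := hU.exists_adj_of_nontrivial ⟨v, hv⟩
      exact hU' ⟨v'.1, v'.2, hv'⟩

theorem WellStructured.prrVia_univ [Finite V] [Fintype T] (hC : C.WellStructured)
    (hG : G.IsAcyclic) : C.net.PRRVia Set.univ := by
  -- A maximal connected vertex set with the invariant exists, since a single vertex carries no edge
  -- and qualifies; were it proper, connectedness of the graph would provide an edge leaving it, and
  -- it could be enlarged.
  obtain ⟨U, ⟨⟨u, hu⟩, hU, hprr⟩, hmax⟩ := Set.Finite.exists_maximal (Set.toFinite
    {U : Set V | U.Nonempty ∧ (G.induce U).Preconnected ∧ C.net.PRRVia (C.transitionsIn U)}) (by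
      obtain ⟨v⟩ := C.connected.nonempty
      refine ⟨{v}, Set.singleton_nonempty v, ?_, ?_⟩
      · exact SimpleGraph.Preconnected.of_subsingleton
      · have : C.transitionsIn {v} = ∅ := Set.eq_empty_iff_forall_notMem.2 fun t ht => by
          have hte := C.edgeOf_mem t
          simp only [transitionsIn, Set.mem_ofPred_eq] at ht
          generalize C.edgeOf t = e at ht hte
          induction e using Sym2.ind with
          | _ a b =>
          exact hte.ne ((ht a (Sym2.mem_mk_left a b)).trans (ht b (Sym2.mem_mk_right a b)).symm)
        exact this ▸ PetriNet.PRRVia.empty _)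
  have hUniv : U = Set.univ := by
    by_contra hne
    obtain ⟨w, hw⟩ := (Set.ne_univ_iff_exists_notMem U).1 hne
    obtain ⟨v, w, hvw, hv, hw⟩ : ∃ v w, G.Adj v w ∧ v ∈ U ∧ w ∉ U := by
      obtain ⟨p⟩ := C.connected.preconnected u w
      obtain ⟨d, -, h1, h2⟩ := p.exists_boundary_dart U hu hw
      exact ⟨d.fst, d.snd, d.adj, h1, h2⟩
    refine hw (hmax (y := insert w U) ⟨Set.insert_nonempty w U, ?_,
      hC.prrVia_transitionsIn_insert hG hU hprr hv hw hvw⟩ (Set.subset_insert w U)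
      (Set.mem_insert w U))
    have hbase : ∀ x : ↥(insert w U), ((G.induce (insert w U)).Reachable ⟨v, Or.inr hv⟩ x) := by
      rintro ⟨x, rfl | hx⟩
      · exact SimpleGraph.Adj.reachable hvw
      · exact (hU ⟨v, hv⟩ ⟨x, hx⟩).map
          (SimpleGraph.induceHomOfLE G (Set.subset_insert w U)).toHom
    exact fun x y => (hbase x).symm.trans (hbase y)
  have : C.transitionsIn U = Set.univ := by
    simp [transitionsIn, hUniv]
  exact this ▸ hprr

end PCMGLe

theorem mainTheorem4 {V P T : Type*} [Finite V] [Fintype P] [Fintype T]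
    (G : SimpleGraph V) (hG : G.IsAcyclic)
    (C : PCMGLe G P T) (hC : C.WellStructured)
    (M₀ : C.Place → ℕ) (hlive : PetriSystem.Live ⟨C.net, M₀⟩) :
    PetriSystem.PropertyR ⟨C.net, M₀⟩ ∧ PetriSystem.PRREquality ⟨C.net, M₀⟩ :=
  PetriSystem.propertyR_and_PRREquality (hC.prrVia_univ hG) hlive
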